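/- Let $n\ge 0$ be an integer and let $\mathrm{Sym}(2^n)$ be the symmetric group on $X_n=\{1,\dots,2^n\}$. For $0\le m\le n$ let $\mathcal B^n_m$ be the partition of $X_n$ into the $2^m$ blocks $\{k2^{n-m}+1,\dots,(k+1)2^{n-m}\}$, $0\le k\le 2^m-1$, and let $\Sigma_n=\bigcap_{m=1}^n \mathrm{Stab}_{\mathrm{Sym}(2^n)}(\mathcal B^n_m)$, where the stabilizer of a partition consists of the permutations that map blocks to blocks. For $n\ge 1$ let $s_n=\prod_{j=1}^{2^{n-1}}(j,\,j+2^{n-1})$, and define recursively $t^n_n=s_n$ and $t^n_i=t^{n-1}_i\cdot s_n^{-1}t^{n-1}_i s_n$ for $1\le i<n$, where $\mathrm{Sym}(2^{n-1})$ is regarded as the subgroup of $\mathrm{Sym}(2^n)$ fixing $2^{n-1}+1,\dots,2^n$ pointwise. Let $T_n=\langle t^n_1,\dots,t^n_n\rangle$ and $U_n=N_{\Sigma_n}(T_n)$. Define the normalizer chain by $N^0_n=U_n$ and $N^k_n=N_{\mathrm{Sym}(2^n)}(N^{k-1}_n)$ for $k\ge 1$. Then $\Sigma_n$ is a Sylow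 $2$-subgroup of $\mathrm{Sym}(2^n)$, and 1. for every $k\ge 1$, $N^k_n=N_{\Sigma_n}(N^{k-1}_n)$; 2. for every $k\ge 0$, $N^k_n$ is contained in $\Sigma_n$ and is a $2$-group; 3. there is $d\in\mathbb N$ (depending on $n$) such that $N^k_n=\Sigma_n$ for all $k\ge d$. -/

import Mathlib

open scoped Pointwise

namespace NormalizerChain

/-- The symmetric group on the `2 ^ n` points `0, …, 2 ^ n - 1`
(the point `x` here stands for `x + 1` in the labelling `1, …, 2 ^ n`). -/
abbrev SymGroup (n : ℕ) : Type := Equiv.Perm (Fin (2 ^ n))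

/-- The block `B_{m,k} = {k * 2 ^ (n - m), …, (k + 1) * 2 ^ (n - m) - 1}`. -/
def block (n m k : ℕ) : Set (Fin (2 ^ n)) :=
  {x | k * 2 ^ (n - m) ≤ (x : ℕ) ∧ (x : ℕ) < (k + 1) * 2 ^ (n - m)}

/-- The partition `{B_{m,0}, …, B_{m,2 ^ m - 1}}` of the set of points, used for `m ≤ n`. -/
def blockSystem (n m : ℕ) : Set (Set (Fin (2 ^ n))) :=
  {B | ∃ k < 2 ^ m, B = block n m k}

/-- `Σ_n`: the intersection of the stabilizers in `Sym(2 ^ n)` of the partitions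
`blockSystem n m`, `1 ≤ m ≤ n` (blocks of a partition may be permuted). -/
def sylowSigma (n : ℕ) : Subgroup (SymGroup n) :=
  ⨅ m ∈ Set.Icc 1 n, MulAction.stabilizer (SymGroup n) (blockSystem n m)

/-- The permutation `s_n` of `Sym(2 ^ n)` for `n ≥ 1`, the product of the pairwise disjoint
transpositions `(j, j + 2 ^ (n - 1))` with `0 ≤ j < 2 ^ (n - 1)`. -/
def halfSwap (n : ℕ) : SymGroup n :=
  ((List.range (2 ^ (n - 1))).map fun j =>
    Equiv.swap (Fin.ofNat (2 ^ n) j) (Fin.ofNat (2 ^ n) (j + 2 ^ (n - 1)))).prod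

/-- A permutation of the first `2 ^ n` points, seen as a permutation of `2 ^ (n + 1)` points
that fixes the remaining ones. -/
def extend {n : ℕ} (g : SymGroup n) : SymGroup (n + 1) :=
  g.viaFintypeEmbedding (Fin.castLEEmb (Nat.pow_le_pow_right Nat.two_pos n.le_succ))

/-- The generators `t_i` (`1 ≤ i ≤ n`) of `T_n`: `t_n = s_n` at level `n`, and for `i < n` the
product of the generator `t_i` of level `n - 1` and of its conjugate by `s_n`. -/
def tGen : (n : ℕ) → ℕ → SymGroup n
  | 0, _ => 1
  | n + 1, i =>
    if i = n + 1 then halfSwap (n + 1)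
    else extend (tGen n i) *
      ((halfSwap (n + 1))⁻¹ * extend (tGen n i) * halfSwap (n + 1))

/-- `T_n = ⟨t_1, …, t_n⟩`. -/
def translationGroup (n : ℕ) : Subgroup (SymGroup n) :=
  Subgroup.closure (tGen n '' Set.Icc 1 n)

/-- `N_K(H) = {g ∈ K | g H g⁻¹ = H}`. -/
def normalizerIn {G : Type*} [Group G] (K H : Subgroup G) : Subgroup G :=
  K ⊓ Subgroup.normalizer (H : Set G)

/-- `U_n = N_{Σ_n}(T_n)`. -/
def sylowU (n : ℕ) : Subgroup (SymGroup n) :=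
  normalizerIn (sylowSigma n) (translationGroup n)

/-- The normalizer chain: `N^0 = U_n` and `N^k` is the normalizer of `N^{k-1}` in the whole
symmetric group `Sym(2 ^ n)`, for `k ≥ 1`. -/
def normalizerChain (n : ℕ) : ℕ → Subgroup (SymGroup n)
  | 0 => sylowU n
  | k + 1 => Subgroup.normalizer (normalizerChain n k : Set (SymGroup n))

end NormalizerChain

namespace NormalizerChain

/-! ### Self-normalizing subgroups of `p`-groups -/

/-! Everything rests on one fact, `normalizer_le_sylowSigma`: if `U_n ≤ H ≤ Σ_n`, then the
normalizer of `H` in the whole of `Sym(2 ^ n)` already lies in `Σ_n`. Induction then keeps the chain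
inside the 2-group `Σ_n`, and it can only become stationary at `Σ_n`, because proper subgroups of a
finite `p`-group grow under normalizers. With `H = Σ_n` the same argument shows that `Σ_n` equals
any Sylow subgroup containing it, so no orders are computed.

The fact itself is a pigeonhole argument. On points read as binary vectors, `U_n` contains all
translations and the linear shears `x ↦ x + x_j c` with `c < 2 ^ j`. If `g` normalizes `H` and glues
points `x`, `y` of different `2 ^ d`-blocks into one, then it does so for every `H`-translate of the
pair. Translations and shears supply enough translates to put `2 ^ d + 1` points into a block of
size `2 ^ d`. -/

/-- A subgroup of a finite `p`-group `P` containing its normalizer in `P` is all of `P`. -/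
theorem eq_of_normalizerIn_le {G : Type*} [Group G] [Finite G] {p : ℕ} [Fact p.Prime]
    {H P : Subgroup G} (hP : IsPGroup p P) (hHP : H ≤ P) (hN : normalizerIn P H ≤ H) :
    H = P := by
  have : Group.IsNilpotent P := hP.isNilpotent
  have hcond : NormalizerCondition P := Group.normalizerCondition_of_isNilpotent
  refine le_antisymm hHP ?_
  rw [← Subgroup.subgroupOf_eq_top]
  by_contra hne
  obtain ⟨x, hx, hxH⟩ := SetLike.exists_of_lt (hcond _ (lt_top_iff_ne_top.mpr hne))
  refine hxH (Subgroup.mem_subgroupOf.mpr (hN ⟨x.2, ?_⟩))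
  rw [Subgroup.mem_normalizer_iff] at hx
  change (x : G) ∈ Subgroup.normalizer (H : Set G)
  rw [Subgroup.mem_normalizer_iff]
  intro h
  constructor
  · intro hh
    exact (hx ⟨h, hHP hh⟩).mp hh
  · intro hh
    have hhP : h ∈ P := by
      have := P.mul_mem (P.mul_mem (P.inv_mem x.2) (hHP hh)) x.2
      simpa [mul_assoc] using this
    exact (hx ⟨h, hhP⟩).mpr hh

/-! ### Permutations respecting the blocks -/

theorem mem_block_iff {n m k : ℕ} {x : Fin (2 ^ n)} :
    x ∈ block n m k ↔ (x : ℕ) / 2 ^ (n - m) = k := by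
  rw [block, Set.mem_ofPred_eq, Nat.div_eq_iff (by positivity)]
  have : 0 < 2 ^ (n - m) := by positivity
  have : (k + 1) * 2 ^ (n - m) = k * 2 ^ (n - m) + 2 ^ (n - m) := by ring
  omega

theorem div_two_pow_lt {n m : ℕ} (hm : m ≤ n) (x : Fin (2 ^ n)) :
    (x : ℕ) / 2 ^ (n - m) < 2 ^ m := by
  rw [Nat.div_lt_iff_lt_mul (by positivity), ← pow_add, Nat.add_sub_cancel' hm]
  exact x.2

/-- Here `d = n - m` is the exponent of the block size. Letting `d` exceed `n - 1` costs nothing,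
since there is then a single class. -/
theorem mem_sylowSigma_iff {n : ℕ} {g : SymGroup n} :
    g ∈ sylowSigma n ↔ ∀ (d : ℕ) (x y : Fin (2 ^ n)),
      (x : ℕ) / 2 ^ d = (y : ℕ) / 2 ^ d ↔ (g x : ℕ) / 2 ^ d = (g y : ℕ) / 2 ^ d := by
  constructor
  · have key : ∀ g ∈ sylowSigma n, ∀ (d : ℕ) (x y : Fin (2 ^ n)),
        (x : ℕ) / 2 ^ d = (y : ℕ) / 2 ^ d → (g x : ℕ) / 2 ^ d = (g y : ℕ) / 2 ^ d := by
      intro g hg d x y hxy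
      rcases le_or_gt n d with hd | hd
      · have hlt : ∀ z : Fin (2 ^ n), (z : ℕ) < 2 ^ d := fun z =>
          z.2.trans_le (Nat.pow_le_pow_right two_pos hd)
        rw [Nat.div_eq_of_lt (hlt _), Nat.div_eq_of_lt (hlt _)]
      · simp only [sylowSigma, Subgroup.mem_iInf] at hg
        have hs := hg (n - d) ⟨by omega, by omega⟩
        rw [MulAction.mem_stabilizer_iff] at hs
        have hnd : n - (n - d) = d := by omega
        have hmem : g • block n (n - d) ((x : ℕ) / 2 ^ d) ∈ blockSystem n (n - d) := by
          rw [← hs]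
          refine Set.smul_mem_smul_set ⟨_, ?_, rfl⟩
          have := div_two_pow_lt (Nat.sub_le n d) x
          rwa [hnd] at this
        obtain ⟨k, -, hk⟩ := hmem
        have himg : ∀ z : Fin (2 ^ n), (z : ℕ) / 2 ^ d = (x : ℕ) / 2 ^ d →
            (g z : ℕ) / 2 ^ d = k := by
          intro z hz
          have : g • z ∈ g • block n (n - d) ((x : ℕ) / 2 ^ d) :=
            Set.smul_mem_smul_set (by rw [mem_block_iff, hnd, hz])
          rw [hk, mem_block_iff, hnd] at this
          exact this
        rw [himg x rfl, himg y hxy.symm]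
    intro hg d x y
    refine ⟨key g hg d x y, fun h => ?_⟩
    have := key g⁻¹ (inv_mem hg) d _ _ h
    simpa using this
  · intro hg
    simp only [sylowSigma, Subgroup.mem_iInf]
    rintro m ⟨-, hm⟩
    rw [MulAction.mem_stabilizer_iff]
    -- The block system is finite and `g` preserves cardinality, so one inclusion suffices.
    refine Set.eq_of_subset_of_ncard_le ?_ (Set.ncard_smul_set _ _).ge (Set.toFinite _)
    rintro _ ⟨_, ⟨k, hk, rfl⟩, rfl⟩
    have hx : k * 2 ^ (n - m) < 2 ^ n := by
      calc k * 2 ^ (n - m) < 2 ^ m * 2 ^ (n - m) := by gcongr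
        _ = 2 ^ n := by rw [← pow_add, Nat.add_sub_cancel' hm]
    refine ⟨_, div_two_pow_lt hm (g ⟨_, hx⟩), ?_⟩
    ext z
    change z ∈ g • block n m k ↔ _
    rw [Set.mem_smul_set_iff_inv_smul_mem, mem_block_iff, mem_block_iff, Equiv.Perm.smul_def]
    have := hg (n - m) (g⁻¹ z) ⟨_, hx⟩
    simpa [Nat.mul_div_cancel] using this

/-- An involution mapping blocks into blocks lies in `Σ_n`. -/
theorem mem_sylowSigma_of_involutive {n : ℕ} {g : SymGroup n} (hg : Function.Involutive g)
    (h : ∀ (d : ℕ) (x y : Fin (2 ^ n)), (x : ℕ) / 2 ^ d = (y : ℕ) / 2 ^ d →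
      (g x : ℕ) / 2 ^ d = (g y : ℕ) / 2 ^ d) : g ∈ sylowSigma n := by
  rw [mem_sylowSigma_iff]
  refine fun d x y => ⟨h d x y, fun hxy => ?_⟩
  have := h d _ _ hxy
  rwa [hg, hg] at this

/-- `g ^ 2 ^ m` fixes each block of size `2 ^ (n - m)`: it permutes the two halves of such a block,
so its square fixes both halves. -/
theorem isPGroup_sylowSigma (n : ℕ) : IsPGroup 2 (sylowSigma n) := by
  rintro ⟨g, hg⟩
  have key : ∀ m ≤ n, ∀ x : Fin (2 ^ n),
      ((g ^ 2 ^ m) x : ℕ) / 2 ^ (n - m) = (x : ℕ) / 2 ^ (n - m) := by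
    intro m
    induction m with
    | zero =>
      intro _ x
      rw [Nat.sub_zero, Nat.div_eq_of_lt (Fin.is_lt _), Nat.div_eq_of_lt (Fin.is_lt _)]
    | succ m ih =>
      intro hm x
      have hh := (mem_sylowSigma_iff (g := g ^ 2 ^ m)).mp (pow_mem hg _) (n - (m + 1))
      have hd : n - m = n - (m + 1) + 1 := by omega
      have ih' := ih (by omega)
      simp only [hd, pow_succ, ← Nat.div_div_eq_div_mul] at ih'
      rw [pow_succ, pow_mul, pow_two, Equiv.Perm.mul_apply]
      have h1 := ih' x
      have h2 := ih' ((g ^ 2 ^ m) x)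
      have h3 := hh x ((g ^ 2 ^ m) x)
      omega
  refine ⟨n, Subtype.ext (Equiv.ext fun x => Fin.ext ?_)⟩
  simpa using key n le_rfl x

/-! ### Translations and shears -/

/-- The translation `x ↦ x + c` of the elementary abelian group `{0, …, 2 ^ n - 1}` under
bitwise addition. -/
def xorPerm (n c : ℕ) (hc : c < 2 ^ n) : SymGroup n :=
  Function.Involutive.toPerm (fun x => ⟨x ^^^ c, Nat.xor_lt_two_pow x.2 hc⟩)
    fun x => Fin.ext (by simp)

@[simp]
theorem xorPerm_apply {n c : ℕ} (hc : c < 2 ^ n) (x : Fin (2 ^ n)) :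
    (xorPerm n c hc x : ℕ) = x ^^^ c := rfl

theorem xorPerm_mem_sylowSigma {n c : ℕ} (hc : c < 2 ^ n) : xorPerm n c hc ∈ sylowSigma n := by
  refine mem_sylowSigma_of_involutive (fun x => Fin.ext (by simp)) ?_
  intro d x y hxy
  simp [Nat.xor_div_two_pow, hxy]

theorem testBit_of_lt_two_pow {c j k : ℕ} (hc : c < 2 ^ j) (hk : j ≤ k) :
    c.testBit k = false :=
  Nat.testBit_lt_two_pow (hc.trans_le (Nat.pow_le_pow_right two_pos hk))

/-- The map `x ↦ x + x_j c`, where `x_j` is the `j`-th binary digit of `x`. -/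
def shearFun (j c x : ℕ) : ℕ := if x.testBit j then x ^^^ c else x

theorem shearFun_shearFun {j c : ℕ} (hc : c < 2 ^ j) (x : ℕ) :
    shearFun j c (shearFun j c x) = x := by
  have := testBit_of_lt_two_pow hc le_rfl
  by_cases h : x.testBit j <;> simp [shearFun, h, this]

theorem shearFun_xor (j c x y : ℕ) :
    shearFun j c (x ^^^ y) = shearFun j c x ^^^ shearFun j c y := by
  apply Nat.eq_of_testBit_eq
  intro i
  by_cases hx : x.testBit j <;> by_cases hy : y.testBit j <;>
    cases hi : c.testBit i <;> cases hxi : x.testBit i <;> cases hyi : y.testBit i <;>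
    simp [shearFun, hx, hy, hi, hxi, hyi]

theorem shearFun_lt {n j c x : ℕ} (hj : j < n) (hc : c < 2 ^ j) (hx : x < 2 ^ n) :
    shearFun j c x < 2 ^ n := by
  unfold shearFun
  split_ifs
  · exact Nat.xor_lt_two_pow hx (hc.trans (Nat.pow_lt_pow_right one_lt_two hj))
  · exact hx

/-- The linear map `x ↦ x + x_j c` with `c < 2 ^ j`, as a permutation. -/
def shear (n j c : ℕ) (hj : j < n) (hc : c < 2 ^ j) : SymGroup n :=
  Function.Involutive.toPerm (fun x => ⟨shearFun j c x, shearFun_lt hj hc x.2⟩)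
    fun x => Fin.ext (shearFun_shearFun hc x)

@[simp]
theorem shear_apply {n j c : ℕ} (hj : j < n) (hc : c < 2 ^ j) (x : Fin (2 ^ n)) :
    (shear n j c hj hc x : ℕ) = shearFun j c x := rfl

theorem shear_involutive {n j c : ℕ} (hj : j < n) (hc : c < 2 ^ j) :
    Function.Involutive (shear n j c hj hc) := fun x => Fin.ext (shearFun_shearFun hc x)

theorem shear_mem_sylowSigma {n j c : ℕ} (hj : j < n) (hc : c < 2 ^ j) :
    shear n j c hj hc ∈ sylowSigma n := by
  refine mem_sylowSigma_of_involutive (shear_involutive hj hc) ?_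
  intro d x y hxy
  rcases le_or_gt d j with hd | hd
  · have hbit : (x : ℕ).testBit j = (y : ℕ).testBit j := by
      have := congrArg (fun z => z.testBit (j - d)) hxy
      simpa [Nat.testBit_div_two_pow, Nat.sub_add_cancel hd] using this
    simp only [shear_apply, shearFun, hbit]
    split_ifs <;> simp [Nat.xor_div_two_pow, hxy]
  · have hcd : c / 2 ^ d = 0 :=
      Nat.div_eq_of_lt (hc.trans (Nat.pow_lt_pow_right one_lt_two hd))
    have : ∀ z : ℕ, shearFun j c z / 2 ^ d = z / 2 ^ d := by
      intro z
      unfold shearFun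
      split_ifs <;> simp [Nat.xor_div_two_pow, hcd]
    simp [this, hxy]

/-! ### The generators of `T_n` -/

/-- Stated for partial products so that induction on `k` applies. -/
theorem prod_swap_apply (n k : ℕ) (hk : k ≤ 2 ^ n) (x : Fin (2 ^ (n + 1))) :
    (((List.range k).map fun j =>
      Equiv.swap (Fin.ofNat (2 ^ (n + 1)) j) (Fin.ofNat (2 ^ (n + 1)) (j + 2 ^ n))).prod x : ℕ) =
      if (x : ℕ) < k then (x : ℕ) + 2 ^ n
      else if 2 ^ n ≤ (x : ℕ) ∧ (x : ℕ) < 2 ^ n + k then (x : ℕ) - 2 ^ n else x := by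
  have hn : 2 ^ (n + 1) = 2 * 2 ^ n := by ring
  induction k generalizing x with
  | zero => simp
  | succ k ih =>
    rw [List.range_succ, List.map_append, List.prod_append, List.map_singleton,
      List.prod_singleton, Equiv.Perm.mul_apply, ih (by omega)]
    have h1 : ((Fin.ofNat (2 ^ (n + 1)) k : Fin _) : ℕ) = k :=
      Nat.mod_eq_of_lt (by omega)
    have h2 : ((Fin.ofNat (2 ^ (n + 1)) (k + 2 ^ n) : Fin _) : ℕ) = k + 2 ^ n :=
      Nat.mod_eq_of_lt (by omega)
    rw [Equiv.swap_apply_def]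
    simp only [Fin.ext_iff, h1, h2]
    have := x.2
    split_ifs <;> omega

theorem add_two_pow_eq_xor {n x : ℕ} (hx : x < 2 ^ n) : x + 2 ^ n = x ^^^ 2 ^ n := by
  apply Nat.eq_of_testBit_eq
  intro i
  rw [add_comm, Nat.testBit_xor, Nat.testBit_two_pow]
  rcases lt_trichotomy i n with h | rfl | h
  · rw [Nat.testBit_two_pow_add_gt h]; simp [h.ne']
  · rw [Nat.testBit_two_pow_add_eq]; simp
  · rw [testBit_of_lt_two_pow hx h.le, testBit_of_lt_two_pow (j := n + 1) (by omega) h]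
    simp [h.ne]

theorem halfSwap_eq (n : ℕ) :
    halfSwap (n + 1) = xorPerm (n + 1) (2 ^ n) (Nat.pow_lt_pow_succ one_lt_two) := by
  ext x
  have hx : (x : ℕ) < 2 * 2 ^ n := x.2.trans_eq (by ring)
  rw [halfSwap, Nat.add_sub_cancel, prod_swap_apply n _ le_rfl, xorPerm_apply]
  split_ifs with h1 h2
  · exact add_two_pow_eq_xor h1
  · have := add_two_pow_eq_xor (n := n) (x := x - 2 ^ n) (by omega)
    rw [Nat.sub_add_cancel h2.1] at this
    conv_rhs => rw [this]
    simp
  · omega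

theorem extend_apply_of_lt {n : ℕ} (g : SymGroup n) (x : Fin (2 ^ (n + 1)))
    (hx : (x : ℕ) < 2 ^ n) : (extend g x : ℕ) = g ⟨x, hx⟩ := by
  have := g.viaFintypeEmbedding_apply_image
    (Fin.castLEEmb (Nat.pow_le_pow_right Nat.two_pos n.le_succ)) ⟨x, hx⟩
  exact congrArg Fin.val this

theorem extend_apply_of_le {n : ℕ} (g : SymGroup n) (x : Fin (2 ^ (n + 1)))
    (hx : 2 ^ n ≤ (x : ℕ)) : extend g x = x := by
  apply Equiv.Perm.viaFintypeEmbedding_apply_notMem_range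
  rintro ⟨y, rfl⟩
  exact absurd y.2 (not_lt.mpr hx)

/-- Exactly one factor acts on each half of the points: `extend` on the lower one, its conjugate by
the half swap on the upper one. -/
theorem tGen_eq {n i : ℕ} (hi : i < n) :
    tGen n (i + 1) = xorPerm n (2 ^ i) (Nat.pow_lt_pow_right one_lt_two hi) := by
  induction n with
  | zero => omega
  | succ n ih =>
    rw [tGen]
    split_ifs with h
    · obtain rfl : i = n := by omega
      exact halfSwap_eq i
    · have hin : i < n := by omega
      have hlt : 2 ^ i < 2 ^ n := Nat.pow_lt_pow_right one_lt_two hin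
      have hn : 2 ^ (n + 1) = 2 * 2 ^ n := by ring
      have hinv : (halfSwap (n + 1))⁻¹ = halfSwap (n + 1) := by
        rw [inv_eq_iff_mul_eq_one, halfSwap_eq]
        ext x
        simp
      rw [hinv, ih hin]
      have hs : ∀ x, (halfSwap (n + 1) x : ℕ) = x ^^^ 2 ^ n := by
        intro x; rw [halfSwap_eq, xorPerm_apply]
      ext x
      simp only [Equiv.Perm.mul_apply, xorPerm_apply]
      rcases lt_or_ge (x : ℕ) (2 ^ n) with hx | hx
      · have h1 : 2 ^ n ≤ (halfSwap (n + 1) x : ℕ) := by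
          rw [hs, ← add_two_pow_eq_xor hx]; omega
        have h2 : halfSwap (n + 1) (halfSwap (n + 1) x) = x :=
          Fin.ext (by rw [hs, hs]; simp)
        rw [extend_apply_of_le _ _ h1, h2, extend_apply_of_lt _ _ hx, xorPerm_apply]
      · have hx2 := x.2
        have hy : (x : ℕ) - 2 ^ n < 2 ^ n := by omega
        have hxy : (x : ℕ) = (x - 2 ^ n) ^^^ 2 ^ n := by
          rw [← add_two_pow_eq_xor hy]; omega
        have h1 : (halfSwap (n + 1) x : ℕ) < 2 ^ n := by
          rw [hs, hxy]; simpa [Nat.xor_assoc] using hy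
        have h3 : ∀ z : Fin (2 ^ (n + 1)), (z : ℕ) < 2 ^ n → 2 ^ n ≤ (halfSwap (n + 1) z : ℕ) := by
          intro z hz; rw [hs, ← add_two_pow_eq_xor hz]; omega
        have h4 := extend_apply_of_lt (xorPerm n (2 ^ i) hlt) _ h1
        rw [xorPerm_apply] at h4
        rw [extend_apply_of_le _ _ (h3 _ ?_), hs, h4, hs]
        · simp only [Nat.xor_assoc, Nat.xor_comm (2 ^ i)]
          rw [← Nat.xor_assoc (2 ^ n), Nat.xor_self, Nat.zero_xor]
        · rw [h4]; exact Nat.xor_lt_two_pow h1 hlt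

theorem xorPerm_mem_translationGroup {n c : ℕ} (hc : c < 2 ^ n) :
    xorPerm n c hc ∈ translationGroup n := by
  have key : ∀ k ≤ n, ∀ (c : ℕ) (hc : c < 2 ^ n), c < 2 ^ k →
      xorPerm n c hc ∈ translationGroup n := by
    intro k
    induction k with
    | zero =>
      intro _ c hc hc0
      obtain rfl : c = 0 := by simpa using hc0
      have : xorPerm n 0 hc = 1 := by ext x; simp
      rw [this]
      exact one_mem _
    | succ k ih =>
      intro hk c hc hck
      rcases lt_or_ge c (2 ^ k) with h | h
      · exact ih (by omega) c hc h
      -- The top digit of `c` is split off; translation by it is a generator.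
      · have hk2 : 2 ^ (k + 1) = 2 * 2 ^ k := by ring
        have hb : c - 2 ^ k < 2 ^ k := by omega
        have hcb : c = (c - 2 ^ k) ^^^ 2 ^ k := by
          rw [← add_two_pow_eq_xor hb]; omega
        have hgen : tGen n (k + 1) ∈ translationGroup n :=
          Subgroup.subset_closure ⟨k + 1, ⟨by omega, hk⟩, rfl⟩
        have := mul_mem hgen (ih (by omega) (c - 2 ^ k) (by omega) hb)
        convert this using 1
        rw [tGen_eq (by omega)]
        ext x
        simp only [xorPerm_apply, Equiv.Perm.mul_apply]
        conv_lhs => rw [hcb]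
        rw [Nat.xor_assoc]
  exact key n le_rfl c hc hc

theorem exists_eq_xorPerm {n : ℕ} {g : SymGroup n} (hg : g ∈ translationGroup n) :
    ∃ c, ∃ hc : c < 2 ^ n, g = xorPerm n c hc := by
  induction hg using Subgroup.closure_induction with
  | mem g hg =>
    obtain ⟨i, ⟨hi1, hin⟩, rfl⟩ := hg
    obtain ⟨i, rfl⟩ : ∃ j, i = j + 1 := ⟨i - 1, by omega⟩
    exact ⟨_, _, tGen_eq (by omega)⟩
  | one => exact ⟨0, by positivity, by ext x; simp⟩
  | mul a b _ _ ha hb =>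
    obtain ⟨c, hc, rfl⟩ := ha
    obtain ⟨e, he, rfl⟩ := hb
    exact ⟨e ^^^ c, Nat.xor_lt_two_pow he hc, by ext x; simp [Nat.xor_assoc]⟩
  | inv a _ ha =>
    obtain ⟨c, hc, rfl⟩ := ha
    refine ⟨c, hc, ?_⟩
    rw [inv_eq_iff_mul_eq_one]
    ext x
    simp

theorem xorPerm_mem_sylowU {n c : ℕ} (hc : c < 2 ^ n) : xorPerm n c hc ∈ sylowU n :=
  ⟨xorPerm_mem_sylowSigma hc, Subgroup.le_normalizer (xorPerm_mem_translationGroup hc)⟩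

/-- A shear is linear, so conjugation by it turns translation by `e` into translation by the image
of `e`. -/
theorem shear_mem_sylowU {n j c : ℕ} (hj : j < n) (hc : c < 2 ^ j) :
    shear n j c hj hc ∈ sylowU n := by
  have hinv : (shear n j c hj hc)⁻¹ = shear n j c hj hc := by
    rw [inv_eq_iff_mul_eq_one]
    exact Equiv.ext (shear_involutive hj hc)
  have hconj : ∀ t ∈ translationGroup n,
      shear n j c hj hc * t * (shear n j c hj hc)⁻¹ ∈ translationGroup n := by
    intro t ht
    obtain ⟨e, he, rfl⟩ := exists_eq_xorPerm ht
    have : shear n j c hj hc * xorPerm n e he * (shear n j c hj hc)⁻¹ =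
        xorPerm n (shearFun j c e) (shearFun_lt hj hc he) := by
      rw [hinv]
      ext x
      simp [shearFun_xor, shearFun_shearFun hc]
    rw [this]
    exact xorPerm_mem_translationGroup _
  refine ⟨shear_mem_sylowSigma hj hc, ?_⟩
  change _ ∈ Subgroup.normalizer _
  rw [Subgroup.mem_normalizer_iff]
  refine fun t => ⟨hconj t, fun ht => ?_⟩
  have := hconj _ ht
  rw [hinv] at this
  have hs := mul_eq_one_iff_inv_eq.mpr hinv
  simpa [mul_assoc, hs, ← mul_assoc (shear n j c hj hc) (shear n j c hj hc)] using this

/-! ### Overgroups of `U_n` in `Σ_n` have their normalizer in `Σ_n` -/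

/-- If `U_n ≤ H ≤ Σ_n` then the preimage under an element of `N(H)` of a block of size `2 ^ d`
is contained in such a block. -/
theorem div_eq_of_mem_normalizer {n : ℕ} {H : Subgroup (SymGroup n)} (hU : sylowU n ≤ H)
    (hS : H ≤ sylowSigma n) {g : SymGroup n} (hg : g ∈ Subgroup.normalizer (H : Set (SymGroup n)))
    {d : ℕ} {x y : Fin (2 ^ n)} (hxy : (g x : ℕ) / 2 ^ d = (g y : ℕ) / 2 ^ d) :
    (x : ℕ) / 2 ^ d = (y : ℕ) / 2 ^ d := by
  by_contra hne
  set z : ℕ := x ^^^ y with hz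
  have hzn : z < 2 ^ n := Nat.xor_lt_two_pow x.2 y.2
  have hzd : 2 ^ d ≤ z := by
    by_contra hlt
    have h0 : z / 2 ^ d = 0 := Nat.div_eq_of_lt (not_le.mp hlt)
    rw [hz, Nat.xor_div_two_pow, Nat.xor_eq_zero_iff] at h0
    exact hne h0
  obtain ⟨j, hj1, hj2⟩ :=
    Nat.exists_most_significant_bit (n := z) (by have := Nat.two_pow_pos d; omega)
  have hdj : d ≤ j := by
    have : z < 2 ^ (j + 1) := Nat.lt_pow_two_of_testBit z fun i hi => hj2 i hi
    have := (Nat.pow_lt_pow_iff_right one_lt_two).mp (hzd.trans_lt this)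
    omega
  have hjn : j < n := by
    by_contra hle
    rw [testBit_of_lt_two_pow hzn (not_lt.mp hle)] at hj1
    exact Bool.false_ne_true hj1
  have hdn : 2 ^ d ≤ 2 ^ j := Nat.pow_le_pow_right two_pos hdj
  have hcn : ∀ c < 2 ^ d, z ^^^ c < 2 ^ n := fun c hc =>
    Nat.xor_lt_two_pow hzn ((hc.trans_le hdn).trans (Nat.pow_lt_pow_right one_lt_two hjn))
  -- `g * h * g⁻¹` lies in `H ≤ Σ_n`, so it preserves the `2 ^ d`-blocks.
  have hinvariant : ∀ h ∈ H, (g (h x) : ℕ) / 2 ^ d = (g (h y) : ℕ) / 2 ^ d := by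
    intro h hh
    have hmem := hS ((Subgroup.mem_normalizer_iff.mp hg h).mp hh)
    have := (mem_sylowSigma_iff.mp hmem d _ _).mp hxy
    simpa using this
  -- Translation by `y` sends `(x, y)` to `(z, 0)`; as `z` has digit `j` set, the shear sends this
  -- to `(z ^^^ c, 0)`.
  have hclass : ∀ (c : ℕ) (hc : c < 2 ^ d),
      (g ⟨z ^^^ c, hcn c hc⟩ : ℕ) / 2 ^ d = (g ⟨0, Nat.two_pow_pos n⟩ : ℕ) / 2 ^ d := by
    intro c hc
    have := hinvariant _ (mul_mem (hU (shear_mem_sylowU hjn (hc.trans_le hdn)))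
      (hU (xorPerm_mem_sylowU y.2)))
    convert this using 4
    · refine Fin.ext ?_
      simp [shearFun, ← hz, hj1, Equiv.Perm.mul_apply, -Nat.testBit_xor]
    · refine Fin.ext ?_
      simp [shearFun, Equiv.Perm.mul_apply]
  set k := (g ⟨0, Nat.two_pow_pos n⟩ : ℕ) / 2 ^ d with hk
  -- `none` stands for the point `0`, which differs from every `z ^^^ c` because `c < 2 ^ d ≤ z`.
  let p : Option (Fin (2 ^ d)) → Fin (2 ^ n) := fun o =>
    o.elim ⟨0, Nat.two_pow_pos n⟩ fun c => ⟨z ^^^ c, hcn c c.2⟩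
  have hp : Function.Injective p := by
    have hne0 : ∀ c : Fin (2 ^ d), z ^^^ (c : ℕ) ≠ 0 := by
      intro c h
      rw [Nat.xor_eq_zero_iff] at h
      have := c.2
      omega
    rintro (_ | a) (_ | b) hab
    · rfl
    · exact absurd (Fin.ext_iff.mp hab).symm (hne0 b)
    · exact absurd (Fin.ext_iff.mp hab) (hne0 a)
    · have := Nat.xor_right_injective (Fin.ext_iff.mp hab)
      rw [Fin.ext this]
  have hgp : ∀ o, (g (p o) : ℕ) / 2 ^ d = k := by
    rintro (_ | c)
    · rfl
    · exact hclass c c.2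
  let q : Option (Fin (2 ^ d)) → Fin (2 ^ d) := fun o =>
    ⟨(g (p o) : ℕ) % 2 ^ d, Nat.mod_lt _ (by positivity)⟩
  have hq : Function.Injective q := by
    intro a b hab
    apply hp
    apply g.injective
    refine Fin.ext ?_
    rw [← Nat.div_add_mod (g (p a) : ℕ) (2 ^ d), ← Nat.div_add_mod (g (p b) : ℕ) (2 ^ d), hgp, hgp]
    exact congrArg _ (Fin.ext_iff.mp hab)
  have := Fintype.card_le_of_injective q hq
  simp at this

theorem normalizer_le_sylowSigma {n : ℕ} {H : Subgroup (SymGroup n)} (hU : sylowU n ≤ H)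
    (hS : H ≤ sylowSigma n) :
    Subgroup.normalizer (H : Set (SymGroup n)) ≤ sylowSigma n := by
  intro g hg
  rw [mem_sylowSigma_iff]
  refine fun d x y => ⟨fun h => ?_, div_eq_of_mem_normalizer hU hS hg⟩
  exact div_eq_of_mem_normalizer hU hS (inv_mem hg) (by simpa using h)

theorem exists_sylow_eq_sylowSigma (n : ℕ) :
    ∃ P : Sylow 2 (SymGroup n), (P : Subgroup (SymGroup n)) = sylowSigma n := by
  obtain ⟨P, hP⟩ := (isPGroup_sylowSigma n).exists_le_sylow
  exact ⟨P, (eq_of_normalizerIn_le P.isPGroup' hP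
    (inf_le_right.trans (normalizer_le_sylowSigma inf_le_left le_rfl))).symm⟩

/-! ### The normalizer chain -/

theorem normalizerChain_monotone (n : ℕ) : Monotone (normalizerChain n) :=
  monotone_nat_of_le_succ fun _ => Subgroup.le_normalizer

theorem normalizerChain_le_sylowSigma (n k : ℕ) : normalizerChain n k ≤ sylowSigma n := by
  induction k with
  | zero => exact inf_le_left
  | succ k ih => exact normalizer_le_sylowSigma (normalizerChain_monotone n k.zero_le) ih

theorem exists_normalizerChain_eq_sylowSigma (n : ℕ) :
    ∃ d : ℕ, ∀ k : ℕ, d ≤ k → normalizerChain n k = sylowSigma n := by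
  -- Where the ascending chain stabilizes, its term is its own normalizer.
  obtain ⟨d, hd⟩ := WellFoundedGT.monotone_chain_condition
    (⟨normalizerChain n, normalizerChain_monotone n⟩ : ℕ →o Subgroup (SymGroup n))
  have hd' : normalizerChain n d = sylowSigma n :=
    eq_of_normalizerIn_le (isPGroup_sylowSigma n) (normalizerChain_le_sylowSigma n d)
      (inf_le_right.trans (hd (d + 1) d.le_succ).ge)
  exact ⟨d, fun k hk => (hd k hk).symm.trans hd'⟩

end NormalizerChain

theorem mainTheorem2 (n : ℕ) :
    (∃ P : Sylow 2 (NormalizerChain.SymGroup n),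
      (P : Subgroup (NormalizerChain.SymGroup n)) = NormalizerChain.sylowSigma n) ∧
    (∀ k : ℕ, 1 ≤ k →
      NormalizerChain.normalizerChain n k =
        NormalizerChain.normalizerIn (NormalizerChain.sylowSigma n)
          (NormalizerChain.normalizerChain n (k - 1))) ∧
    (∀ k : ℕ, NormalizerChain.normalizerChain n k ≤ NormalizerChain.sylowSigma n ∧
      IsPGroup 2 (NormalizerChain.normalizerChain n k)) ∧
    (∃ d : ℕ, ∀ k : ℕ, d ≤ k →
      NormalizerChain.normalizerChain n k = NormalizerChain.sylowSigma n) := by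
  refine ⟨NormalizerChain.exists_sylow_eq_sylowSigma n, ?_, fun k => ?_,
    NormalizerChain.exists_normalizerChain_eq_sylowSigma n⟩
  · rintro (_ | k) hk
    · omega
    · exact (inf_eq_right.mpr (NormalizerChain.normalizerChain_le_sylowSigma n (k + 1))).symm
  · have hle := NormalizerChain.normalizerChain_le_sylowSigma n k
    exact ⟨hle, (NormalizerChain.isPGroup_sylowSigma n).to_le hle⟩
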